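/- **Lemma.** All graphs are finite, simple and undirected. Let $G$ be a graph. - Two subgraphs of $G$ *touch* if they share a vertex or some edge of $G$ has one endpoint in each. A *bramble* in $G$ is a set of (nonempty) connected subgraphs of $G$ that pairwise touch. Its *order* is the minimum size of a set of vertices that intersects every element of the bramble. The *bramble number* $\mathrm{bn}(G)$ is the maximum order of a bramble in $G$. - A set $S\subseteq V(G)$ is *$k$-linked* if for every set $X$ of fewer than $k$ vertices of $G$, some component of $G-X$ contains more than half of the vertices in $S$. The *linkedness* $\mathrm{link}(G)$ is the maximum integer $k\ge 1$ for which $G$ contains a $k$-linked set (and $\mathrm{link}(G)=0$ if $G$ has no vertices). - A set $S\subseteq V(G)$ is *well-linked* if for all $A,B\subseteq S$ with $|A|=|B|$ (not necessarily disjoint), there are $|A|$ pairwise vertex-disjoint paths in $G$, each from a vertex of $A$ to a vertex of $B$, where a single vertex of $A\cap B$ counts as a path. The *well-linked number* $\mathrm{wl}(G)$ is the maximum size of a well-linked set in $G$. Then, for every graph $G$, $$\mathrm{bn}(G)\;\le\;\mathrm{wl}(G)\;\le\;3\,\mathrm{link}(G)\;\le\;3\,\mathrm{bn}(G).$$ 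-/

import Mathlib

namespace SimpleGraph

variable {V : Type*} {G : SimpleGraph V}

/-- Two subgraphs touch if they share a vertex, or some edge of `G` has one endpoint in each. -/
def Touch (A B : G.Subgraph) : Prop :=
  (A.verts ∩ B.verts).Nonempty ∨ ∃ a ∈ A.verts, ∃ b ∈ B.verts, G.Adj a b

/-- A bramble: a set of (nonempty) connected subgraphs that pairwise touch. -/
structure IsBramble (β : Set G.Subgraph) : Prop where
  connected : ∀ A ∈ β, A.Connected
  touch : ∀ A ∈ β, ∀ B ∈ β, Touch A B

/-- `S` is a hitting set of `β` if it intersects every element of `β`. -/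
def IsHittingSet (β : Set G.Subgraph) (S : Finset V) : Prop :=
  ∀ A ∈ β, ∃ v ∈ S, v ∈ A.verts

/-- The order of `β`: the minimum size of a hitting set. -/
noncomputable def brambleOrder (β : Set G.Subgraph) : ℕ :=
  sInf {n | ∃ S : Finset V, IsHittingSet β S ∧ S.card = n}

/-- The bramble number: the maximum order of a bramble. -/
noncomputable def brambleNumber (G : SimpleGraph V) : ℕ :=
  sSup {n | ∃ β : Set G.Subgraph, IsBramble β ∧ brambleOrder β = n}

/-- `S` is `k`-linked: for every set `X` of fewer than `k` vertices, some component of `G - X`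
contains more than half of the vertices of `S`. (Every set is `0`-linked.) -/
def IsLinkedSet (G : SimpleGraph V) (k : ℕ) (S : Finset V) : Prop :=
  ∀ X : Finset V, X.card < k →
    ∃ C : (G.induce ((X : Set V)ᶜ)).ConnectedComponent,
      S.card < 2 * ((S : Set V) ∩ (Subtype.val '' C.supp)).ncard

/-- The linkedness: the maximum `k` for which there is a `k`-linked set
(it is `0` exactly for the graph without vertices). -/
noncomputable def linkedness (G : SimpleGraph V) : ℕ :=
  sSup {k | ∃ S : Finset V, G.IsLinkedSet k S}

/-- There are `n` pairwise vertex-disjoint paths in `G`, each from a vertex of `A` to a vertex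
of `B`. A path may consist of a single vertex of `A ∩ B`. -/
def HasDisjointPaths (G : SimpleGraph V) (A B : Finset V) (n : ℕ) : Prop :=
  ∃ (s t : Fin n → V) (p : ∀ i, G.Walk (s i) (t i)),
    (∀ i, s i ∈ A ∧ t i ∈ B ∧ (p i).IsPath) ∧
    ∀ i j, i ≠ j → List.Disjoint (p i).support (p j).support

/-- `S` is well-linked: any `A, B ⊆ S` of equal size, not necessarily disjoint, are joined by
`|A|` vertex-disjoint paths. -/
def IsWellLinked (G : SimpleGraph V) (S : Finset V) : Prop :=
  ∀ A B : Finset V, A ⊆ S → B ⊆ S → A.card = B.card → G.HasDisjointPaths A B A.card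

/-- The well-linked number: the maximum size of a well-linked set. -/
noncomputable def wellLinkedNumber (G : SimpleGraph V) : ℕ :=
  sSup {n | ∃ S : Finset V, G.IsWellLinked S ∧ S.card = n}

/-! The extrema above are attained in a finite graph. -/

theorem IsBramble.exists_minimum_hittingSet [Finite V] {β : Set G.Subgraph} (hβ : IsBramble β) :
    IsLeast {n | ∃ S : Finset V, IsHittingSet β S ∧ S.card = n} (brambleOrder β) := by
  have := Fintype.ofFinite V
  have hne : {n | ∃ S : Finset V, IsHittingSet β S ∧ S.card = n}.Nonempty :=
    ⟨_, Finset.univ, fun A hA => by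
      obtain ⟨v, hv⟩ := (hβ.connected A hA).nonempty
      exact ⟨v, Finset.mem_univ v, hv⟩, rfl⟩
  exact ⟨Nat.sInf_mem hne, fun n hn => Nat.sInf_le hn⟩

theorem isGreatest_brambleNumber [Finite V] (G : SimpleGraph V) :
    IsGreatest {n | ∃ β : Set G.Subgraph, IsBramble β ∧ brambleOrder β = n} G.brambleNumber := by
  have := Fintype.ofFinite V
  have hb : BddAbove {n | ∃ β : Set G.Subgraph, IsBramble β ∧ brambleOrder β = n} := by
    refine ⟨Fintype.card V, ?_⟩
    rintro n ⟨β, hβ, rfl⟩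
    obtain ⟨S, -, hS⟩ := hβ.exists_minimum_hittingSet.1
    exact hS ▸ Finset.card_le_univ S
  exact ⟨Nat.sSup_mem ⟨_, ∅, ⟨by simp, by simp⟩, rfl⟩ hb, fun n hn => le_csSup hb hn⟩

theorem isGreatest_linkedness [Finite V] (G : SimpleGraph V) :
    IsGreatest {k | ∃ S : Finset V, G.IsLinkedSet k S} G.linkedness := by
  have := Fintype.ofFinite V
  have hb : BddAbove {k | ∃ S : Finset V, G.IsLinkedSet k S} := by
    refine ⟨Fintype.card V, ?_⟩
    rintro k ⟨S, hS⟩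
    by_contra hk
    obtain ⟨C, -⟩ := hS Finset.univ (not_le.1 hk)
    obtain ⟨v, -⟩ := C.nonempty_supp
    exact v.2 (by simp)
  exact ⟨Nat.sSup_mem ⟨0, ∅, fun X hX => absurd hX (Nat.not_lt_zero _)⟩ hb,
    fun n hn => le_csSup hb hn⟩

theorem isGreatest_wellLinkedNumber [Finite V] (G : SimpleGraph V) :
    IsGreatest {n | ∃ S : Finset V, G.IsWellLinked S ∧ S.card = n} G.wellLinkedNumber := by
  have := Fintype.ofFinite V
  have hb : BddAbove {n | ∃ S : Finset V, G.IsWellLinked S ∧ S.card = n} := by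
    refine ⟨Fintype.card V, ?_⟩
    rintro n ⟨S, -, rfl⟩
    exact Finset.card_le_univ S
  refine ⟨Nat.sSup_mem ⟨0, ∅, ?_, rfl⟩ hb, fun n hn => le_csSup hb hn⟩
  intro A B hA _ _
  obtain rfl := Finset.subset_empty.1 hA
  exact ⟨Fin.elim0, Fin.elim0, fun i => i.elim0, fun i => i.elim0, fun i => i.elim0⟩

end SimpleGraph

/-! Each inequality compares a small set `X` with a minimum or a majority. A minimum hitting set `S`
of a bramble is well-linked. If `X` with `|X| < |A|` separated `A` from `B`, then exchanging `A`, or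
`B`, for `X` in `S` would give too small a hitting set. So some bramble element avoids `X` and meets
`A`, another avoids `X` and meets `B`. They touch, hence contain a walk around `X`. Menger's theorem
(`hasDisjointPaths_of_separates_card_le`, by induction on `G` through edge deletion) then gives the
paths. If `S` is well-linked and no component of `G - X` has a majority of `S`, where `3|X| < |S|`,
the components can be grouped so that more than `|X|` vertices of `S` lie in the group and more than
`|X|` outside it. Disjoint paths between the two sides would all need to meet `X`
(`IsWellLinked.isLinkedSet`). Majority components for a linked set intersect pairwise, so they form
a bramble. -/

namespace SimpleGraph

/-! ### Separators and families of disjoint paths -/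

section Separation

variable {V : Type*}

/-- `X` separates `A` from `B`: every walk from `A` to `B` meets `X`. -/
def Separates (G : SimpleGraph V) (A B X : Finset V) : Prop :=
  ∀ a ∈ A, ∀ b ∈ B, ∀ w : G.Walk a b, ∃ u ∈ w.support, u ∈ X

/-- The vertices that can be reached from `A` without meeting `X`. -/
def reachAvoiding (G : SimpleGraph V) (A X : Finset V) : Set V :=
  {v | ∃ a ∈ A, ∃ w : G.Walk a v, ∀ u ∈ w.support, u ∉ X}

theorem Separates.symm {G : SimpleGraph V} {A B X : Finset V} (h : G.Separates A B X) :
    G.Separates B A X := fun b hb a ha w => by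
  simpa using h a ha b hb w.reverse

theorem mem_reachAvoiding_of_mem_support [DecidableEq V] {G : SimpleGraph V} {A X : Finset V}
    {a v u : V} (ha : a ∈ A) (w : G.Walk a v) (hw : ∀ u ∈ w.support, u ∉ X) (hu : u ∈ w.support) :
    u ∈ G.reachAvoiding A X :=
  ⟨a, ha, w.takeUntil u hu, fun x hx => hw x (w.support_takeUntil_subset_support hu hx)⟩

theorem reachAvoiding_of_adj {G : SimpleGraph V} {A X : Finset V} {u v : V}
    (hu : u ∈ G.reachAvoiding A X) (huv : G.Adj u v) (hv : v ∉ X) : v ∈ G.reachAvoiding A X := by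
  obtain ⟨a, ha, w, hw⟩ := hu
  refine ⟨a, ha, w.concat huv, fun x hx => ?_⟩
  rw [Walk.support_concat, List.mem_append, List.mem_singleton] at hx
  rcases hx with hx | rfl
  exacts [hw x hx, hv]

/-- Suppose `G` and `H` differ only in the edge `xy`, `X` separates `A` from `B` in `H`, and `y`
cannot be reached from `A` in `H - X`. Then every separator of `A` from `X ∪ {x}` in `H` separates
`A` from `B` in `G`. -/
theorem Separates.of_separates_insert [DecidableEq V] {G H : SimpleGraph V} {A B X Y : Finset V}
    {x y : V} (hGH : ∀ u v, G.Adj u v → ¬ H.Adj u v → s(u, v) = s(x, y))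
    (hX : H.Separates A B X) (hy : y ∉ H.reachAvoiding A X)
    (hY : H.Separates A (insert x X) Y) : G.Separates A B Y := by
  intro a ha b hb w
  by_contra! hw
  -- A walk of `G` that avoids `Y` can leave this reachable set only along `xy`; but `x` is excluded
  -- here, and `y` by `hy` and `key'`.
  have key : ∀ v ∈ H.reachAvoiding A Y, v ∉ insert x X := by
    rintro v ⟨a', ha', w', hw'⟩ hv
    obtain ⟨u, hu, huY⟩ := hY a' ha' v hv w'
    exact hw' u hu huY
  have key' : H.reachAvoiding A Y ⊆ H.reachAvoiding A X := by
    rintro v ⟨a', ha', w', hw'⟩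
    exact ⟨a', ha', w', fun u hu huX =>
      key u (mem_reachAvoiding_of_mem_support ha' w' hw' hu) (Finset.mem_insert_of_mem huX)⟩
  have haR : a ∈ H.reachAvoiding A Y :=
    ⟨a, ha, Walk.nil, by simpa using hw a w.start_mem_support⟩
  have hbR : b ∉ H.reachAvoiding A Y := by
    intro hb'
    obtain ⟨a', ha', w', hw'⟩ := key' hb'
    obtain ⟨u, hu, huX⟩ := hX a' ha' b hb w'
    exact hw' u hu huX
  obtain ⟨d, hd, hd1, hd2⟩ := w.exists_boundary_dart _ haR hbR
  have hnadj : ¬ H.Adj d.fst d.snd := fun h =>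
    hd2 (reachAvoiding_of_adj hd1 h (hw _ (w.dart_snd_mem_support_of_mem_darts hd)))
  have := hGH _ _ d.adj hnadj
  rw [Sym2.eq_iff] at this
  rcases this with ⟨h1, -⟩ | ⟨h1, -⟩
  · exact key _ hd1 (by simp [h1])
  · exact hy (h1 ▸ key' hd1)

theorem HasDisjointPaths.of_walks {G : SimpleGraph V} {A B : Finset V} {ι : Type*} [Fintype ι]
    (s t : ι → V) (p : ∀ i, G.Walk (s i) (t i)) (hs : ∀ i, s i ∈ A) (ht : ∀ i, t i ∈ B)
    (hp : ∀ i j, i ≠ j → List.Disjoint (p i).support (p j).support) :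
    G.HasDisjointPaths A B (Fintype.card ι) := by
  classical
  let e := (Fintype.equivFin ι).symm
  refine ⟨fun i => s (e i), fun i => t (e i), fun i => (p (e i)).bypass,
    fun i => ⟨hs _, ht _, Walk.bypass_isPath _⟩, fun i j hij => ?_⟩
  exact List.disjoint_of_subset_left (Walk.support_bypass_subset_support _)
    (List.disjoint_of_subset_right (Walk.support_bypass_subset_support _)
      (hp _ _ (e.injective.ne hij)))

theorem HasDisjointPaths.symm {G : SimpleGraph V} {A B : Finset V} {n : ℕ}
    (h : G.HasDisjointPaths A B n) : G.HasDisjointPaths B A n := by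
  obtain ⟨s, t, p, hp, hd⟩ := h
  refine ⟨t, s, fun i => (p i).reverse, fun i => ⟨(hp i).2.1, (hp i).1, (hp i).2.2.reverse⟩, ?_⟩
  intro i j hij
  simpa [List.Disjoint] using hd i j hij

/-- As many disjoint paths to `B` as `B` has vertices can be indexed by their ends. -/
theorem HasDisjointPaths.exists_indexed_by_ends [DecidableEq V] {G : SimpleGraph V} {A : Finset V}
    {ι : Type*} [Fintype ι] {g : ι → V}
    (h : G.HasDisjointPaths A (Finset.univ.image g) (Fintype.card ι)) :
    ∃ (s : ι → V) (p : ∀ i, G.Walk (s i) (g i)), (∀ i, s i ∈ A ∧ (p i).IsPath) ∧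
      ∀ i j, i ≠ j → List.Disjoint (p i).support (p j).support := by
  obtain ⟨s, t, p, hp, hd⟩ := h
  have hg : ∀ i, ∃ j, g j = t i := fun i => by simpa using (hp i).2.1
  choose f hf using hg
  have hinj : Function.Injective f := by
    intro i j hij
    by_contra hne
    refine hd i j hne (p i).end_mem_support ?_
    rw [← hf i, hij, hf j]
    exact (p j).end_mem_support
  have hbij := (Fintype.bijective_iff_injective_and_card f).2 ⟨hinj, by simp⟩
  let e := Equiv.ofBijective f hbij
  have he : ∀ j, t (e.symm j) = g j := fun j => by
    rw [← hf]
    exact congrArg g (e.apply_symm_apply j)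
  refine ⟨fun j => s (e.symm j), fun j => (p (e.symm j)).copy rfl (he j),
    fun j => ⟨(hp _).1, by simpa using (hp (e.symm j)).2.2⟩, fun i j hij => ?_⟩
  simpa using hd _ _ (e.symm.injective.ne hij)

/-- A path visits its end only once. In `glue` this forces a crossing point to be the end of the
path. -/
theorem Walk.IsPath.end_notMem_support_takeUntil [DecidableEq V] {G : SimpleGraph V} {u v z : V}
    {p : G.Walk u v} (hp : p.IsPath) (hz : z ∈ p.support)
    (hv : v ∈ (p.takeUntil z hz).support) : z = v := by
  by_contra hne
  exact Walk.endpoint_notMem_support_takeUntil hp hz (Ne.symm hne) hv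

end Separation

end SimpleGraph

namespace SimpleGraph

/-! ### Menger's theorem -/

section Menger

variable {V : Type*}

/-- If `X` separates `A` from `B` in `H`, disjoint paths from `A` to `X ∪ {x}` and from `B` to
`X ∪ {y}` in `H` combine with an edge `xy` to disjoint paths from `A` to `B`. -/
theorem HasDisjointPaths.glue [DecidableEq V] {G H : SimpleGraph V} {A B X : Finset V} {x y : V}
    (hHG : H ≤ G) (hxy : G.Adj x y) (hX : H.Separates A B X)
    (hA : H.HasDisjointPaths A (insert x X) (X.card + 1))
    (hB : H.HasDisjointPaths B (insert y X) (X.card + 1)) :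
    G.HasDisjointPaths A B (X.card + 1) := by
  -- The index `none` stands for the extra end, `x` or `y`; with the common ends in `X`, this
  -- matches the two families.
  let g : V → Option X → V := fun z i => i.elim z Subtype.val
  have hg : ∀ z, Finset.univ.image (g z) = insert z X := by
    intro z
    ext v
    simp [g, Option.exists, eq_comm]
  have hcard : Fintype.card (Option X) = X.card + 1 := by simp
  rw [← hcard, ← hg] at hA hB
  obtain ⟨s, p, hp, hpd⟩ := hA.exists_indexed_by_ends
  obtain ⟨t, q, hq, hqd⟩ := hB.exists_indexed_by_ends
  -- Switching paths at `z` gives a walk from `A` to `B` in `H`, which meets `X` in some `w`. As `w`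
  -- ends both `p c` and `q c`, disjointness forces `i = c` or `j = c`, and then `z = w`, which lies
  -- on two paths of one family.
  have meet : ∀ i j z, i ≠ j → z ∈ (p i).support → z ∉ (q j).support := by
    intro i j z hij hzp hzq
    obtain ⟨w, hw, hwX⟩ := hX _ (hp i).1 _ (hq j).1
      (((p i).takeUntil z hzp).append ((q j).takeUntil z hzq).reverse)
    rw [Walk.mem_support_append_iff, Walk.support_reverse, List.mem_reverse] at hw
    let c : Option X := some ⟨w, hwX⟩
    have hpc : w ∈ (p c).support := (p c).end_mem_support
    have hqc : w ∈ (q c).support := (q c).end_mem_support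
    rcases hw with hw | hw
    · have hic : i = c := by
        by_contra hne
        exact hpd i c hne ((p i).support_takeUntil_subset_support hzp hw) hpc
      subst hic
      obtain rfl : z = w := (hp c).2.end_notMem_support_takeUntil hzp hw
      exact hqd c j hij hqc hzq
    · have hjc : j = c := by
        by_contra hne
        exact hqd j c hne ((q j).support_takeUntil_subset_support hzq hw) hqc
      subst hjc
      obtain rfl : z = w := (hq c).2.end_notMem_support_takeUntil hzq hw
      exact hpd i c hij hzp hpc
  have mid : ∀ i, ∃ m : G.Walk (g x i) (g y i), ∀ z ∈ m.support, z = g x i ∨ z = g y i := by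
    rintro (_ | v)
    · exact ⟨hxy.toWalk, by simp [g]⟩
    · exact ⟨(Walk.nil : G.Walk v.1 v.1), by simp [g]⟩
  choose m hm using mid
  rw [← hcard]
  let r : ∀ i, G.Walk (s i) (t i) := fun i =>
    (((p i).mapLe hHG).append (m i)).append ((q i).mapLe hHG).reverse
  have hr : ∀ i, ∀ z ∈ (r i).support, z ∈ (p i).support ∨ z ∈ (q i).support := by
    intro i z hz
    simp only [r, Walk.mem_support_append_iff, Walk.support_reverse, List.mem_reverse,
      Walk.support_mapLe_eq_support] at hz
    rcases hz with (hz | hz) | hz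
    · exact Or.inl hz
    · rcases hm i z hz with rfl | rfl
      · exact Or.inl (p i).end_mem_support
      · exact Or.inr (q i).end_mem_support
    · exact Or.inr hz
  refine HasDisjointPaths.of_walks s t r (fun i => (hp i).1) (fun i => (hq i).1) ?_
  intro i j hij z hzi hzj
  rcases hr i z hzi with hi | hi <;> rcases hr j z hzj with hj | hj
  · exact hpd i j hij hi hj
  · exact meet i j z hij hi hj
  · exact meet j i z hij.symm hj hi
  · exact hqd i j hij hi hj

/-- Menger's theorem for two sets of vertices in a finite graph. -/
theorem hasDisjointPaths_of_separates_card_le [Finite V] (G : SimpleGraph V) {A B : Finset V}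
    {k : ℕ} (h : ∀ X, G.Separates A B X → k ≤ X.card) : G.HasDisjointPaths A B k := by
  classical
  induction G using WellFoundedLT.induction generalizing A B with
  | ind G ih =>
  by_cases hbot : G = ⊥
  · subst hbot
    have hsep : (⊥ : SimpleGraph V).Separates A B (A ∩ B) := by
      rintro a ha b hb (_ | ⟨hadj, -⟩)
      · exact ⟨a, by simp, by simp [ha, hb]⟩
      · exact hadj.elim
    obtain ⟨S, hS, rfl⟩ := Finset.exists_subset_card_eq (h _ hsep)
    have := HasDisjointPaths.of_walks (G := (⊥ : SimpleGraph V)) (A := A) (B := B)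
      (ι := S) (fun v => v) (fun v => v) (fun v => Walk.nil)
      (fun v => (Finset.mem_inter.1 (hS v.2)).1) (fun v => (Finset.mem_inter.1 (hS v.2)).2)
      (fun i j hij => by
        simpa using fun h : (j : V) = i => hij (Subtype.ext h.symm))
    simpa using this
  obtain ⟨u, v, huv⟩ := ne_bot_iff_exists_adj.1 hbot
  set H := G.deleteEdges {s(u, v)} with hH
  have hHG : H ≤ G := deleteEdges_le _
  have hlt : H < G := by
    refine lt_of_le_of_ne hHG fun heq => ?_
    rw [← heq, hH, deleteEdges_adj] at huv
    exact huv.2 rfl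
  have hdiff : ∀ a b, G.Adj a b → ¬ H.Adj a b → s(a, b) = s(u, v) := by
    intro a b hab hnab
    by_contra hne
    exact hnab (deleteEdges_adj.2 ⟨hab, hne⟩)
  by_cases hk : ∀ X, H.Separates A B X → k ≤ X.card
  · obtain ⟨s, t, p, hp, hd⟩ := ih H hlt hk
    refine ⟨s, t, fun i => (p i).mapLe hHG, fun i => ⟨(hp i).1, (hp i).2.1, ?_⟩, ?_⟩
    · simpa using (hp i).2.2
    · simpa using hd
  push Not at hk
  obtain ⟨X, hX, hXk⟩ := hk
  have hXG : ¬ G.Separates A B X := fun hs => hXk.not_ge (h X hs)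
  simp only [Separates] at hXG
  push Not at hXG
  obtain ⟨a, ha, b, hb, w, hw⟩ := hXG
  -- The walk avoids `X`, so it leaves the reachable set along the deleted edge; this orients the
  -- edge, with its first end on the side of `A`.
  obtain ⟨d, hd, hd1, hd2⟩ := w.exists_boundary_dart (H.reachAvoiding A X)
    ⟨a, ha, Walk.nil, by simpa using hw a w.start_mem_support⟩
    (fun ⟨a', ha', w', hw'⟩ => by
      obtain ⟨z, hz, hzX⟩ := hX a' ha' b hb w'
      exact hw' z hz hzX)
  have hy : d.snd ∉ X := hw _ (w.dart_snd_mem_support_of_mem_darts hd)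
  have hnadj : ¬ H.Adj d.fst d.snd := fun hadj => hd2 (reachAvoiding_of_adj hd1 hadj hy)
  have huv' := hdiff _ _ d.adj hnadj
  have hx' : d.fst ∉ H.reachAvoiding B X := by
    rintro ⟨b', hb', w', hw'⟩
    obtain ⟨a', ha', w'', hw''⟩ := hd1
    obtain ⟨z, hz, hzX⟩ := hX a' ha' b' hb' (w''.append w'.reverse)
    rw [Walk.mem_support_append_iff, Walk.support_reverse, List.mem_reverse] at hz
    exact hz.elim (fun hz => hw'' z hz hzX) (fun hz => hw' z hz hzX)
  have hA : ∀ Y, H.Separates A (insert d.fst X) Y → k ≤ Y.card := fun Y hY =>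
    h Y (hX.of_separates_insert (fun a b h1 h2 => (hdiff a b h1 h2).trans huv'.symm) hd2 hY)
  have hB : ∀ Y, H.Separates B (insert d.snd X) Y → k ≤ Y.card := fun Y hY =>
    h Y (hX.symm.of_separates_insert (fun a b h1 h2 =>
      ((hdiff a b h1 h2).trans huv'.symm).trans Sym2.eq_swap) hx' hY).symm
  -- The set `insert d.fst X` separates `A` from itself, so `hA` bounds `k` from above.
  have hcard : k = X.card + 1 := by
    refine le_antisymm (le_trans ?_ (Finset.card_insert_le d.fst X)) hXk
    exact hA _ fun a _ c hc w => ⟨c, w.end_mem_support, hc⟩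
  subst hcard
  exact HasDisjointPaths.glue hHG d.adj hX (ih H hlt hA) (ih H hlt hB)

end Menger

end SimpleGraph

namespace SimpleGraph

/-! ### Brambles against well-linked and linked sets -/

section Brambles

variable {V : Type*} {G : SimpleGraph V}

theorem Subgraph.Connected.exists_walk {A : G.Subgraph} (hA : A.Connected) {u v : V}
    (hu : u ∈ A.verts) (hv : v ∈ A.verts) : ∃ w : G.Walk u v, ∀ z ∈ w.support, z ∈ A.verts := by
  obtain ⟨w, hw⟩ := ((Subgraph.connected_iff_forall_exists_walk_subgraph A).1 hA).2 hu hv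
  exact ⟨w, fun z hz => hw.1 ((w.mem_verts_toSubgraph).2 hz)⟩

theorem Touch.exists_walk {A B : G.Subgraph} (h : Touch A B) (hA : A.Connected)
    (hB : B.Connected) {u v : V} (hu : u ∈ A.verts) (hv : v ∈ B.verts) :
    ∃ w : G.Walk u v, ∀ z ∈ w.support, z ∈ A.verts ∨ z ∈ B.verts := by
  have join : ∃ a ∈ A.verts, ∃ b ∈ B.verts, ∃ m : G.Walk a b,
      ∀ z ∈ m.support, z ∈ A.verts ∨ z ∈ B.verts := by
    rcases h with ⟨a, ha, hb⟩ | ⟨a, ha, b, hb, hab⟩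
    · exact ⟨a, ha, a, hb, Walk.nil, by simp [ha]⟩
    · exact ⟨a, ha, b, hb, hab.toWalk, by simp [ha, hb]⟩
  obtain ⟨a, ha, b, hb, m, hm⟩ := join
  obtain ⟨p, hp⟩ := hA.exists_walk hu ha
  obtain ⟨q, hq⟩ := hB.exists_walk hb hv
  refine ⟨(p.append m).append q, fun z hz => ?_⟩
  rw [Walk.mem_support_append_iff, Walk.mem_support_append_iff] at hz
  rcases hz with (hz | hz) | hz
  exacts [Or.inl (hp z hz), hm z hz, Or.inr (hq z hz)]

/-- A minimum hitting set of a bramble is well-linked. -/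
theorem IsBramble.isWellLinked [Finite V] {β : Set G.Subgraph} (hβ : IsBramble β) {S : Finset V}
    (hS : IsHittingSet β S) (hcard : S.card = brambleOrder β) : G.IsWellLinked S := by
  classical
  intro A B hA hB hAB
  refine hasDisjointPaths_of_separates_card_le G fun X hX => ?_
  by_contra! hlt
  -- `X ∪ (S \ T)` is smaller than `S`, so it misses some `P`; since `S` hits `P`, it does so in
  -- `T`.
  have key : ∀ T ⊆ S, T.card = A.card → ∃ P ∈ β, (∀ z ∈ P.verts, z ∉ X) ∧ ∃ v ∈ T, v ∈ P.verts := by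
    intro T hT hTA
    have hnot : ¬ IsHittingSet β (X ∪ (S \ T)) := by
      intro hhit
      have h1 := hβ.exists_minimum_hittingSet.2 ⟨_, hhit, rfl⟩
      have h2 := Finset.card_union_le X (S \ T)
      have h3 := Finset.card_sdiff_add_card_eq_card hT
      omega
    simp only [IsHittingSet] at hnot
    push Not at hnot
    obtain ⟨P, hP, hPX⟩ := hnot
    obtain ⟨v, hvS, hvP⟩ := hS P hP
    refine ⟨P, hP, fun z hz hzX => hPX z (Finset.mem_union_left _ hzX) hz, v, ?_, hvP⟩
    by_contra hvT
    exact hPX v (Finset.mem_union_right _ (Finset.mem_sdiff.2 ⟨hvS, hvT⟩)) hvP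
  obtain ⟨P, hP, hPX, a, ha, haP⟩ := key A hA rfl
  obtain ⟨Q, hQ, hQX, b, hb, hbQ⟩ := key B hB hAB.symm
  obtain ⟨w, hw⟩ := (hβ.touch P hP Q hQ).exists_walk (hβ.connected P hP) (hβ.connected Q hQ) haP hbQ
  obtain ⟨z, hz, hzX⟩ := hX a ha b hb w
  exact (hw z hz).elim (fun h => hPX z h hzX) (fun h => hQX z h hzX)

theorem brambleNumber_le_wellLinkedNumber [Finite V] (G : SimpleGraph V) :
    G.brambleNumber ≤ G.wellLinkedNumber := by
  obtain ⟨β, hβ, hn⟩ := G.isGreatest_brambleNumber.1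
  obtain ⟨S, hS, hcard⟩ := hβ.exists_minimum_hittingSet.1
  rw [← hn, ← hcard]
  exact G.isGreatest_wellLinkedNumber.2 ⟨S, hβ.isWellLinked hS hcard, rfl⟩

/-- A component of `G - X`, as an induced subgraph of `G`. -/
def componentSubgraph {s : Set V} (C : (G.induce s).ConnectedComponent) : G.Subgraph :=
  (⊤ : G.Subgraph).induce (Subtype.val '' C.supp)

theorem connected_componentSubgraph {s : Set V} (C : (G.induce s).ConnectedComponent) :
    (componentSubgraph C).Connected := by
  rw [Subgraph.connected_iff_forall_exists_walk_subgraph]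
  refine ⟨C.nonempty_supp.image _, ?_⟩
  rintro _ _ ⟨u, hu, rfl⟩ ⟨v, hv, rfl⟩
  obtain ⟨w⟩ := C.reachable_of_mem_supp hu hv
  let m : G.Walk (u : V) v := w.map (Embedding.induce s).toHom
  have hm : m.support = w.support.map Subtype.val := Walk.support_map _ w
  refine ⟨m, (Walk.toSubgraph_le_induce_support _).trans ?_⟩
  refine Subgraph.induce_mono_right ?_
  intro z hz
  rw [Set.mem_ofPred_eq, hm, List.mem_map] at hz
  obtain ⟨x, hx, rfl⟩ := hz
  refine ⟨x, ?_, rfl⟩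
  classical
  rw [ConnectedComponent.mem_supp_iff] at hu ⊢
  rw [← hu, ConnectedComponent.eq]
  exact (w.takeUntil x hx).reverse.reachable

/-- Two sets that each contain more than half of `S` have a common element. -/
theorem inter_nonempty_of_card_lt_two_mul {S : Finset V} {P Q : Set V}
    (hP : S.card < 2 * ((S : Set V) ∩ P).ncard) (hQ : S.card < 2 * ((S : Set V) ∩ Q).ncard) :
    (P ∩ Q).Nonempty := by
  by_contra hne
  rw [Set.not_nonempty_iff_eq_empty] at hne
  have hdisj : Disjoint ((S : Set V) ∩ P) ((S : Set V) ∩ Q) := by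
    rw [Set.disjoint_left]
    rintro z ⟨-, hzP⟩ ⟨-, hzQ⟩
    exact (hne ▸ ⟨hzP, hzQ⟩ : z ∈ (∅ : Set V))
  have h1 := Set.ncard_union_eq hdisj (S.finite_toSet.inter_of_left _)
    (S.finite_toSet.inter_of_left _)
  have h2 : ((S : Set V) ∩ P ∪ (S : Set V) ∩ Q).ncard ≤ S.card := by
    rw [← Set.ncard_coe_finset]
    exact Set.ncard_le_ncard (by simp) S.finite_toSet
  omega

/-- The bramble consists of one majority component of `G - X` for each small `X`. A small hitting
set `T` would miss the component chosen for `X = T`. -/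
theorem linkedness_le_brambleNumber [Finite V] (G : SimpleGraph V) :
    G.linkedness ≤ G.brambleNumber := by
  obtain ⟨S, hS⟩ := G.isGreatest_linkedness.1
  choose C hC using hS
  let β : Set G.Subgraph := {P | ∃ (X : Finset V) (hX : X.card < G.linkedness),
    P = componentSubgraph (C X hX)}
  have hβ : IsBramble β := by
    constructor
    · rintro _ ⟨X, hX, rfl⟩
      exact connected_componentSubgraph _
    · rintro _ ⟨X, hX, rfl⟩ _ ⟨Y, hY, rfl⟩
      exact Or.inl (inter_nonempty_of_card_lt_two_mul (hC X hX) (hC Y hY))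
  refine le_trans ?_ (G.isGreatest_brambleNumber.2 ⟨β, hβ, rfl⟩)
  obtain ⟨T, hT, hcard⟩ := hβ.exists_minimum_hittingSet.1
  rw [← hcard]
  by_contra! hlt
  obtain ⟨v, hvT, z, -, rfl⟩ := hT _ ⟨T, hlt, rfl⟩
  exact z.2 hvT

end Brambles

/-! ### Well-linked sets are linked -/

section WellLinked

variable {V : Type*} {G : SimpleGraph V}

/-- If the vertices of `X` separate `U` from the rest of the graph, then no more than `|X|` disjoint
paths lead from `U` to its complement. -/
theorem HasDisjointPaths.le_card_of_boundary {A B X : Finset V} {U : Set V} {n : ℕ}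
    (h : G.HasDisjointPaths A B n) (hU : ∀ u v, u ∈ U → G.Adj u v → v ∉ X → v ∈ U)
    (hA : ∀ a ∈ A, a ∈ U) (hB : ∀ b ∈ B, b ∉ U) : n ≤ X.card := by
  obtain ⟨s, t, p, hp, hd⟩ := h
  have hit : ∀ i, ∃ z ∈ (p i).support, z ∈ X := by
    intro i
    obtain ⟨d, hd, hd1, hd2⟩ :=
      (p i).exists_boundary_dart U (hA _ (hp i).1) (hB _ (hp i).2.1)
    refine ⟨d.snd, (p i).dart_snd_mem_support_of_mem_darts hd, ?_⟩
    by_contra hX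
    exact hd2 (hU _ _ hd1 d.adj hX)
  choose f hf hfX using hit
  have hinj : Set.InjOn f (Finset.univ : Finset (Fin n)) := by
    intro i _ j _ hij
    by_contra hne
    exact hd i j hne (hf i) (hij ▸ hf j)
  simpa using Finset.card_le_card_of_injOn f (fun i _ => hfX i) hinj

/-- A well-linked set `S` is `⌈|S| / 3⌉`-linked. -/
theorem IsWellLinked.isLinkedSet [Finite V] {S : Finset V} (hS : G.IsWellLinked S) {k : ℕ}
    (hk : 3 * k ≤ S.card + 2) : G.IsLinkedSet k S := by
  classical
  have := Fintype.ofFinite V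
  intro X hX
  by_contra! hC
  have hfin := Fintype.ofFinite (G.induce ((X : Set V)ᶜ)).ConnectedComponent
  let f : (G.induce ((X : Set V)ᶜ)).ConnectedComponent → Finset V :=
    fun C => S.filter (· ∈ Subtype.val '' C.supp)
  let F : Finset (G.induce ((X : Set V)ᶜ)).ConnectedComponent → Finset V := fun T => T.biUnion f
  have hf : ∀ C, 2 * (f C).card ≤ S.card := by
    intro C
    have hcoe : (f C : Set V) = (S : Set V) ∩ Subtype.val '' C.supp := by
      ext v
      simp [f]
    rw [← Set.ncard_coe_finset (f C), hcoe]
    exact hC C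
  have hFS : ∀ T, F T ⊆ S := fun T => Finset.biUnion_subset.2 fun C _ => Finset.filter_subset _ _
  have huniv : X.card < (F Finset.univ).card := by
    have hsub : S \ X ⊆ F Finset.univ := by
      intro v hv
      rw [Finset.mem_sdiff] at hv
      simp only [F, f, Finset.mem_biUnion, Finset.mem_filter]
      exact ⟨(G.induce ((X : Set V)ᶜ)).connectedComponentMk ⟨v, by simpa using hv.2⟩,
        Finset.mem_univ _, hv.1, ⟨v, by simpa using hv.2⟩, rfl, rfl⟩
    have h1 := Finset.card_le_card hsub
    have h2 := Finset.le_card_sdiff X S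
    omega
  -- An inclusion-minimal group of components with more than `|X|` vertices of `S` still leaves more
  -- than `|X|` outside.
  obtain ⟨T, hT⟩ := exists_minimal_of_wellFoundedLT (fun T => X.card < (F T).card) ⟨_, huniv⟩
  have hlarge : X.card < (F T).card := hT.prop
  have hbound : (F T).card + X.card < S.card := by
    have hne : T.Nonempty := by
      rw [Finset.nonempty_iff_ne_empty]
      rintro rfl
      simp [F] at hlarge
    obtain ⟨C, hCT⟩ := hne
    have h1 : (F (T.erase C)).card ≤ X.card := not_lt.1
      (hT.not_prop_of_lt (Finset.erase_ssubset hCT))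
    have h2 : F T = f C ∪ F (T.erase C) := by
      rw [← Finset.biUnion_insert, Finset.insert_erase hCT]
    have h3 := Finset.card_union_le (f C) (F (T.erase C))
    rw [← h2] at h3
    -- If `C` is small, `|F T| ≤ 2|X|` and `3|X| < |S|` suffices. Otherwise minimality gives `T =
    -- {C}`, and `C` has at most half of `S`.
    by_cases h4 : (f C).card ≤ X.card
    · omega
    · have h5 : T = {C} := by
        refine (hT.eq_of_le (y := {C}) ?_ (by simpa using hCT)).symm
        simpa [F] using h4
      have h6 : F T = f C := by simp [h5, F]
      have := hf C
      rw [h6]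
      omega
  obtain ⟨A, hA, hAcard⟩ := Finset.exists_subset_card_eq (Nat.succ_le_of_lt hlarge)
  have hrest : X.card + 1 ≤ (S \ F T).card := by
    have := Finset.card_sdiff_add_card_eq_card (hFS T)
    omega
  obtain ⟨B, hB, hBcard⟩ := Finset.exists_subset_card_eq hrest
  let U : Set V := {v | ∃ C ∈ T, v ∈ Subtype.val '' C.supp}
  have hpaths := hS A B (hA.trans (hFS T)) (hB.trans Finset.sdiff_subset) (hAcard.trans hBcard.symm)
  have hle : A.card ≤ X.card := by
    refine hpaths.le_card_of_boundary (U := U) ?_ ?_ ?_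
    · rintro _ v ⟨C, hCT, u, hu, rfl⟩ huv hv
      refine ⟨C, hCT, ⟨v, by simpa using hv⟩, ?_, rfl⟩
      exact C.mem_supp_of_adj_mem_supp hu (by simpa using huv)
    · intro a ha
      have := hA ha
      simp only [F, f, Finset.mem_biUnion, Finset.mem_filter] at this
      obtain ⟨C, hCT, -, haC⟩ := this
      exact ⟨C, hCT, haC⟩
    · rintro b hb ⟨C, hCT, hbC⟩
      have := Finset.mem_sdiff.1 (hB hb)
      exact this.2 (Finset.mem_biUnion.2 ⟨C, hCT, Finset.mem_filter.2 ⟨this.1, hbC⟩⟩)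
  omega

theorem wellLinkedNumber_le_three_mul_linkedness [Finite V] (G : SimpleGraph V) :
    G.wellLinkedNumber ≤ 3 * G.linkedness := by
  obtain ⟨S, hS, hcard⟩ := G.isGreatest_wellLinkedNumber.1
  -- `(S.card + 2) / 3` is `⌈|S| / 3⌉`, so three times it is at least `|S|`.
  have := G.isGreatest_linkedness.2 ⟨S, hS.isLinkedSet (k := (S.card + 2) / 3) (by omega)⟩
  omega

end WellLinked

end SimpleGraph

theorem mainTheorem9 {V : Type*} [Finite V] (G : SimpleGraph V) :
    G.brambleNumber ≤ G.wellLinkedNumber ∧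
    G.wellLinkedNumber ≤ 3 * G.linkedness ∧
    3 * G.linkedness ≤ 3 * G.brambleNumber :=
  ⟨G.brambleNumber_le_wellLinkedNumber, G.wellLinkedNumber_le_three_mul_linkedness,
    Nat.mul_le_mul_left 3 G.linkedness_le_brambleNumber⟩
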